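/- Let $D$ be an integral domain with quotient field $K$. Let $\overline{\boldsymbol F}(D)$ be the set of nonzero $D$-submodules of $K$, $\boldsymbol F(D)$ the set of nonzero fractional ideals of $D$, and $\boldsymbol f(D)$ the set of nonzero finitely generated fractional ideals. A \emph{semistar operation} of $D$ is a map $\star:\overline{\boldsymbol F}(D)\to\overline{\boldsymbol F}(D)$, $E\mapsto E^\star$, such that for all $0\neq z\in K$ and all $E,F\in\overline{\boldsymbol F}(D)$: $(zE)^\star=zE^\star$; $E\subseteq F$ implies $E^\star\subseteq F^\star$; $E\subseteq E^\star$ and $(E^\star)^\star=E^\star$. A \emph{star operation} of $D$ is a map $\ast:\boldsymbol F(D)\to\boldsymbol F(D)$ with the same properties on $\boldsymbol F(D)$ and with $(zD)^\ast=zD$ for all $0\ne z\in K$. The semistar operation $\star_f$ associated with $\star$ is given by $E^{\star_f}=\bigcup\{F^\star\mid F\in\boldsymbol f(D),\ F\subseteq E\}$, and $\star$ is \emph{of finite type} if $\star=\star_f$ (similarly for star operations). For a family $\mathcal W$ of valuation overrings of $D$ (valuation domains $V$ with $D\subseteq V\subseteq K$), the semistar operation $\wedge_{\mathcal W}: E\mapsto\bigcap\{EV\mid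 V\in\mathcal W\}$ is called a \emph{$\mathcal W$-operation}. For a semistar operation $\star$, let $b(\star):=\wedge_{\mathcal V(\star)}$, where $\mathcal V(\star)$ is the set of valuation overrings $V$ of $D$ with $F^\star\subseteq FV$ for all $F\in\boldsymbol f(D)$; $b(\star)$ is the \emph{complete $\mathcal W$-operation associated with $\star$}, and $\star$ is a \emph{complete $\mathcal W$-operation} if $\star=b(\star)$. Suppose that $D$ is an almost Dedekind domain (that is, $D_M$ is a discrete valuation ring for every maximal ideal $M$ of $D$) with a maximal ideal $M_\infty$ that is not finitely generated, while every other maximal ideal of $D$ is finitely generated. Let $\mathcal W=\{D_M\mid M\in\mathrm{Max}(D),\ M\neq M_\infty\}$ and $\star=\wedge_{\mathcal W}$. Then: 1. every member of $\mathcal W$ is a valuation overring of $D$, so $\star$ is a $\mathcal W$-operation; 2. $D^\star=D$, and the restriction of $\star$ to $\boldsymbol F(D)$ is a star operation of $D$, which is not of finite type; 3. $\star_f$ is the identity operation on $\overline{\boldsymbol F}(D)$; 4. $(M_\infty)^\star=D$; 5. $\star$ is not of finite type; 6. $\star$ is not a complete $\mathcal W$-operation: $\star\neq b(\star)$, and indeed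 $\star\ne b(\star')$ for every semistar operation $\star'$ of $D$. -/

import Mathlib

open scoped Pointwise nonZeroDivisors

namespace Semistar

/-- `D` is almost Dedekind: `D_M` is a discrete valuation ring for every maximal ideal `M`. -/
def IsAlmostDedekind (D : Type*) [CommRing D] [IsDomain D] : Prop :=
  ∀ (M : Ideal D) [M.IsMaximal], IsDiscreteValuationRing (Localization.AtPrime M)

/-- The set of all nonzero `D`-submodules of `K`. -/
abbrev NonzeroSubmodule (D K : Type*) [CommRing D] [Field K] [Algebra D K] : Type _ :=
  {E : Submodule D K // E ≠ ⊥}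

/-- The set of all nonzero fractional ideals of `D` in `K`. -/
abbrev NonzeroFractional (D K : Type*) [CommRing D] [Field K] [Algebra D K] : Type _ :=
  {E : Submodule D K // E ≠ ⊥ ∧ IsFractional D⁰ E}

section

variable {D K : Type*} [CommRing D] [Field K] [Algebra D K]

theorem mem_smul_iff {z : K} (hz : z ≠ 0) {E : Submodule D K} {x : K} :
    x ∈ z • E ↔ z⁻¹ * x ∈ E := by
  constructor
  · intro h
    obtain ⟨e, he, rfl⟩ := (Submodule.mem_smul_pointwise_iff_exists _ _ _).1 h
    simpa [hz] using he
  · intro h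
    refine (Submodule.mem_smul_pointwise_iff_exists _ _ _).2 ⟨_, h, ?_⟩
    simp [hz]

theorem smul_ne_bot {z : K} (hz : z ≠ 0) {E : Submodule D K} (hE : E ≠ ⊥) : z • E ≠ ⊥ := by
  obtain ⟨x, hx, hx0⟩ := (Submodule.ne_bot_iff _).1 hE
  refine (Submodule.ne_bot_iff _).2 ⟨z * x, ?_, mul_ne_zero hz hx0⟩
  rw [mem_smul_iff hz]
  simpa [hz] using hx

theorem ne_bot_of_le {E F : Submodule D K} (hE : E ≠ ⊥) (h : E ≤ F) : F ≠ ⊥ := by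
  rintro rfl
  exact hE (le_bot_iff.1 h)

theorem isFractional_smul (z : K) [IsDomain D] [IsFractionRing D K] {E : Submodule D K}
    (hE : IsFractional D⁰ E) : IsFractional D⁰ (z • E) := by
  obtain ⟨a, ha, h⟩ := hE
  obtain ⟨b, hb⟩ := IsLocalization.exists_integer_multiple D⁰ z
  obtain ⟨c, hc⟩ := hb
  refine ⟨a * b, mul_mem ha b.2, fun x hx => ?_⟩
  obtain ⟨e, he, rfl⟩ := (Submodule.mem_smul_pointwise_iff_exists _ _ _).1 hx
  obtain ⟨d, hd⟩ := h e he
  refine ⟨c * d, ?_⟩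
  rw [map_mul, hc, hd]
  simp only [Algebra.smul_def, map_mul, Algebra.algebraMap_self, RingHom.id_apply]
  ring

/-- The submodule `zE = {z e | e ∈ E}`, for `z ≠ 0`. -/
def NonzeroSubmodule.scale (z : K) (hz : z ≠ 0) (E : NonzeroSubmodule D K) :
    NonzeroSubmodule D K :=
  ⟨z • E.1, smul_ne_bot hz E.2⟩

/-- The fractional ideal `zE = {z e | e ∈ E}`, for `z ≠ 0`. -/
def NonzeroFractional.scale [IsDomain D] [IsFractionRing D K] (z : K) (hz : z ≠ 0)
    (E : NonzeroFractional D K) : NonzeroFractional D K :=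
  ⟨z • E.1, smul_ne_bot hz E.2.1, isFractional_smul z E.2.2⟩

/-- A nonzero fractional ideal, seen as a nonzero submodule of `K`. -/
def NonzeroFractional.toSubmodule (E : NonzeroFractional D K) : NonzeroSubmodule D K :=
  ⟨E.1, E.2.1⟩

variable (D K) in
/-- `D` itself (its image in `K`), as a nonzero submodule of `K`. -/
def NonzeroSubmodule.base : NonzeroSubmodule D K := ⟨1, one_ne_zero⟩

variable (D K) in
/-- `D` itself (its image in `K`), as a nonzero fractional ideal. -/
def NonzeroFractional.base : NonzeroFractional D K := 
  ⟨1, one_ne_zero, FractionalIdeal.isFractional_of_le_one _ le_rfl⟩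

theorem map_ideal_ne_bot [IsFractionRing D K] {I : Ideal D} (hI : I ≠ ⊥) :
    Submodule.map (Algebra.linearMap D K) I ≠ ⊥ := by
  intro h
  apply hI
  refine (Submodule.eq_bot_iff _).2 fun x hx => IsFractionRing.injective D K ?_
  have h1 : algebraMap D K x ∈ Submodule.map (Algebra.linearMap D K) I := ⟨x, hx, rfl⟩
  rw [h, Submodule.mem_bot] at h1
  rw [h1, map_zero]

variable (K) in
/-- A nonzero ideal of `D`, as a nonzero submodule of `K`. -/
def NonzeroSubmodule.ofIdeal [IsFractionRing D K] (I : Ideal D) (hI : I ≠ ⊥) :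
    NonzeroSubmodule D K :=
  ⟨Submodule.map (Algebra.linearMap D K) I, map_ideal_ne_bot hI⟩

theorem ne_bot_of_not_fg {I : Ideal D} (hI : ¬ I.FG) : I ≠ ⊥ := by
  rintro rfl
  exact hI Submodule.fg_bot

end

/-- A semistar operation of `D`. -/
@[ext]
structure SemistarOperation (D K : Type*) [CommRing D] [Field K] [Algebra D K] where
  toFun : NonzeroSubmodule D K → NonzeroSubmodule D K
  map_scale : ∀ (z : K) (hz : z ≠ 0) (E : NonzeroSubmodule D K),
    toFun (E.scale z hz) = (toFun E).scale z hz
  mono : ∀ E F : NonzeroSubmodule D K, E ≤ F → toFun E ≤ toFun F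
  le_self : ∀ E : NonzeroSubmodule D K, E ≤ toFun E
  idem : ∀ E : NonzeroSubmodule D K, toFun (toFun E) = toFun E

/-- A star operation of `D`. -/
@[ext]
structure StarOperation (D K : Type*) [CommRing D] [IsDomain D] [Field K] [Algebra D K]
    [IsFractionRing D K] where
  toFun : NonzeroFractional D K → NonzeroFractional D K
  map_principal : ∀ (z : K) (hz : z ≠ 0),
    toFun ((NonzeroFractional.base D K).scale z hz) = (NonzeroFractional.base D K).scale z hz
  map_scale : ∀ (z : K) (hz : z ≠ 0) (E : NonzeroFractional D K),
    toFun (E.scale z hz) = (toFun E).scale z hz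
  mono : ∀ E F : NonzeroFractional D K, E ≤ F → toFun E ≤ toFun F
  le_self : ∀ E : NonzeroFractional D K, E ≤ toFun E
  idem : ∀ E : NonzeroFractional D K, toFun (toFun E) = toFun E

/-- A star operation `∗` is of finite type if `E^∗` is the union of the `F^∗`, for `F ⊆ E` a
nonzero finitely generated fractional ideal. -/
def StarOperation.IsFiniteType {D K : Type*} [CommRing D] [IsDomain D] [Field K] [Algebra D K]
    [IsFractionRing D K] (s : StarOperation D K) : Prop :=
  ∀ (E : NonzeroFractional D K) (x : K),
    x ∈ (s.toFun E).1 ↔ ∃ F : NonzeroFractional D K, F.1.FG ∧ F ≤ E ∧ x ∈ (s.toFun F).1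

section

variable {D K : Type*} [CommRing D] [Field K] [Algebra D K]

namespace SemistarOperation

variable (D K) in
/-- The identity semistar operation. -/
def identity : SemistarOperation D K where
  toFun E := E
  map_scale _ _ _ := rfl
  mono _ _ h := h
  le_self _ := le_rfl
  idem _ := rfl

theorem exists_fg_mem (E : NonzeroSubmodule D K) {x : K} (hx : x ∈ E.1) :
    ∃ F : NonzeroSubmodule D K, F.1.FG ∧ F ≤ E ∧ x ∈ F.1 := by
  obtain ⟨y, hy, hy0⟩ := (Submodule.ne_bot_iff _).1 E.2
  have hyF : y ∈ Submodule.span D ({x, y} : Set K) := Submodule.subset_span (by simp)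
  refine ⟨⟨Submodule.span D {x, y}, (Submodule.ne_bot_iff _).2 ⟨y, hyF, hy0⟩⟩,
    Submodule.fg_span (by simp), ?_, Submodule.subset_span (by simp)⟩
  refine Submodule.span_le.2 ?_
  rintro z (rfl | rfl)
  exacts [hx, hy]

/-- The submodule `⋃ {F^⋆ | F ⊆ E, F nonzero and finitely generated}` of `K`. -/
def finiteTypeSubmodule (s : SemistarOperation D K) (E : NonzeroSubmodule D K) :
    Submodule D K where
  carrier := {x | ∃ F : NonzeroSubmodule D K, F.1.FG ∧ F ≤ E ∧ x ∈ (s.toFun F).1}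
  zero_mem' := by
    obtain ⟨F, h1, h2, -⟩ := exists_fg_mem E (zero_mem E.1)
    exact ⟨F, h1, h2, zero_mem _⟩
  add_mem' := by
    rintro x y ⟨F, hF, hFE, hx⟩ ⟨G, hG, hGE, hy⟩
    let H : NonzeroSubmodule D K := ⟨F.1 ⊔ G.1, ne_bot_of_le F.2 le_sup_left⟩
    have h1 : F ≤ H := (le_sup_left : F.1 ≤ F.1 ⊔ G.1)
    have h2 : G ≤ H := (le_sup_right : G.1 ≤ F.1 ⊔ G.1)
    exact ⟨H, hF.sup hG, (sup_le hFE hGE : F.1 ⊔ G.1 ≤ E.1),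
      add_mem (s.mono _ _ h1 hx) (s.mono _ _ h2 hy)⟩
  smul_mem' := by
    rintro c x ⟨F, hF, hFE, hx⟩
    exact ⟨F, hF, hFE, Submodule.smul_mem _ c hx⟩

theorem le_finiteTypeSubmodule (s : SemistarOperation D K) (E : NonzeroSubmodule D K) :
    E.1 ≤ s.finiteTypeSubmodule E := by
  intro x hx
  obtain ⟨F, h1, h2, h3⟩ := exists_fg_mem E hx
  exact ⟨F, h1, h2, s.le_self F h3⟩

theorem scale_le_scale_iff {z : K} (hz : z ≠ 0) {E F : NonzeroSubmodule D K} :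
    E.scale z hz ≤ F.scale z hz ↔ E ≤ F := by
  constructor
  · intro h x hx
    have h1 : z * x ∈ z • E.1 := by rw [mem_smul_iff hz]; simpa [hz] using hx
    have h2 : z * x ∈ z • F.1 := h h1
    rw [mem_smul_iff hz] at h2
    simpa [hz] using h2
  · intro h x hx
    have h1 : x ∈ z • E.1 := hx
    rw [mem_smul_iff hz] at h1
    exact (mem_smul_iff hz).2 (h h1)

theorem scale_scale_inv {z : K} (hz : z ≠ 0) (E : NonzeroSubmodule D K) :
    (E.scale z⁻¹ (inv_ne_zero hz)).scale z hz = E := by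
  apply Subtype.ext
  ext x
  change x ∈ z • (z⁻¹ • E.1) ↔ _
  rw [mem_smul_iff hz, mem_smul_iff (inv_ne_zero hz)]
  simp [hz]

theorem scale_fg {z : K} (hz : z ≠ 0) {E : NonzeroSubmodule D K} (hE : E.1.FG) :
    (E.scale z hz).1.FG := hE.map _

theorem exists_fg_le (s : SemistarOperation D K) (E : NonzeroSubmodule D K)
    {F : Submodule D K} (hF : F.FG) (h : F ≤ s.finiteTypeSubmodule E) :
    ∃ G : NonzeroSubmodule D K, G.1.FG ∧ G ≤ E ∧ F ≤ (s.toFun G).1 := by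
  induction F, hF using Submodule.fg_induction with
  | singleton x =>
    obtain ⟨G, h1, h2, h3⟩ := h (Submodule.mem_span_singleton_self x)
    exact ⟨G, h1, h2, (Submodule.span_singleton_le_iff_mem _ _).2 h3⟩
  | sup F₁ F₂ _ _ ih₁ ih₂ =>
    obtain ⟨G₁, h1, h2, h3⟩ := ih₁ (le_sup_left.trans h)
    obtain ⟨G₂, k1, k2, k3⟩ := ih₂ (le_sup_right.trans h)
    let H : NonzeroSubmodule D K := ⟨G₁.1 ⊔ G₂.1, ne_bot_of_le G₁.2 le_sup_left⟩
    have e1 : G₁ ≤ H := (le_sup_left : G₁.1 ≤ G₁.1 ⊔ G₂.1)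
    have e2 : G₂ ≤ H := (le_sup_right : G₂.1 ≤ G₁.1 ⊔ G₂.1)
    exact ⟨H, h1.sup k1, (sup_le h2 k2 : G₁.1 ⊔ G₂.1 ≤ E.1),
      sup_le (h3.trans (s.mono _ _ e1)) (k3.trans (s.mono _ _ e2))⟩

/-- The semistar operation of finite type associated with `⋆`. -/
def finiteType (s : SemistarOperation D K) : SemistarOperation D K where
  toFun E := ⟨s.finiteTypeSubmodule E, ne_bot_of_le E.2 (s.le_finiteTypeSubmodule E)⟩
  map_scale z hz E := by
    apply Subtype.ext
    ext x
    change x ∈ s.finiteTypeSubmodule (E.scale z hz) ↔ x ∈ z • s.finiteTypeSubmodule E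
    rw [mem_smul_iff hz]
    constructor
    · rintro ⟨F, hF, hFE, hx⟩
      refine ⟨F.scale z⁻¹ (inv_ne_zero hz), scale_fg _ hF, ?_, ?_⟩
      · rwa [← scale_le_scale_iff hz, scale_scale_inv]
      · rw [s.map_scale]
        exact (mem_smul_iff (inv_ne_zero hz)).2 (by simpa [hz] using hx)
    · rintro ⟨F, hF, hFE, hx⟩
      refine ⟨F.scale z hz, scale_fg _ hF, (scale_le_scale_iff hz).2 hFE, ?_⟩
      rw [s.map_scale]
      exact (mem_smul_iff hz).2 hx
  mono := by
    rintro E F h x ⟨G, hG, hGE, hx⟩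
    exact ⟨G, hG, hGE.trans h, hx⟩
  le_self E := s.le_finiteTypeSubmodule E
  idem E := by
    refine le_antisymm ?_ (s.le_finiteTypeSubmodule _)
    rintro x ⟨F, hF, hFE, hx⟩
    obtain ⟨G, h1, h2, h3⟩ := s.exists_fg_le E hF hFE
    have h4 := s.mono F (s.toFun G) h3 hx
    rw [s.idem] at h4
    exact ⟨G, h1, h2, h4⟩

/-- `⋆` is of finite type. -/
def IsFiniteType (s : SemistarOperation D K) : Prop := s = s.finiteType

theorem le_mul_overring (E : Submodule D K) (V : Subalgebra D K) :
    E ≤ E * Subalgebra.toSubmodule V := by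
  intro x hx
  have h1 : (1 : K) ∈ Subalgebra.toSubmodule V := V.one_mem
  simpa using Submodule.mul_mem_mul hx h1

/-- The operation `∧_W : E ↦ ⋂ {E V | V ∈ W}`, for a family `W` of overrings of `D` inside `K`. -/
def wedge (W : Set (Subalgebra D K)) : SemistarOperation D K where
  toFun E := ⟨⨅ V ∈ W, E.1 * Subalgebra.toSubmodule V,
    ne_bot_of_le E.2 (le_iInf₂ fun V _ => le_mul_overring E.1 V)⟩
  map_scale z hz E := by
    apply Subtype.ext
    ext x
    change x ∈ ⨅ V ∈ W, (z • E.1) * Subalgebra.toSubmodule V ↔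
      x ∈ z • ⨅ V ∈ W, E.1 * Subalgebra.toSubmodule V
    rw [mem_smul_iff hz]
    simp only [Submodule.mem_iInf]
    refine forall₂_congr fun V _ => ?_
    rw [← mem_smul_iff hz, smul_mul_assoc]
  mono E F h := by
    refine (iInf₂_mono fun V _ => mul_le_mul' h le_rfl :
      (⨅ V ∈ W, E.1 * Subalgebra.toSubmodule V) ≤ ⨅ V ∈ W, F.1 * Subalgebra.toSubmodule V)
  le_self E := le_iInf₂ fun V _ => le_mul_overring E.1 V
  idem E := by
    apply Subtype.ext
    refine le_antisymm ?_ (le_iInf₂ fun V _ => le_mul_overring _ V)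
    refine le_iInf₂ fun V hV => (iInf₂_le V hV).trans ?_
    refine (mul_le_mul' (iInf₂_le V hV) le_rfl).trans ?_
    rw [mul_assoc, (Subalgebra.isIdempotentElem_toSubmodule V).eq]

/-- The set `𝒱(⋆)` of `⋆`-valuation overrings: the valuation domains `V` with `D ⊆ V ⊆ K` and
`F^⋆ ⊆ F V` for all nonzero finitely generated `F`. -/
def valuationOverrings (s : SemistarOperation D K) : Set (Subalgebra D K) :=
  {V | ValuationRing V ∧ ∀ F : NonzeroSubmodule D K, F.1.FG →
    (s.toFun F).1 ≤ F.1 * Subalgebra.toSubmodule V}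

/-- `⋆` is a `W`-operation: `⋆ = ∧_W` for a family `W` of valuation overrings of `D`. -/
def IsWOperation (s : SemistarOperation D K) : Prop :=
  ∃ W : Set (Subalgebra D K), (∀ V ∈ W, ValuationRing V) ∧ s = wedge W

/-- `b(⋆)`, the complete `W`-operation associated with `⋆`. -/
def complete (s : SemistarOperation D K) : SemistarOperation D K :=
  wedge s.valuationOverrings

/-- `⋆` is a complete `W`-operation if `⋆ = b(⋆)`. -/
def IsCompleteWOperation (s : SemistarOperation D K) : Prop := s = s.complete

end SemistarOperation

end

variable (K : Type*) {D : Type*} [CommRing D] [IsDomain D] [Field K] [Algebra D K]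
  [IsFractionRing D K] in
/-- The overring `D_M` of `D` inside `K`. -/
noncomputable def localizationAt (M : Ideal D) [M.IsPrime] : Subalgebra D K :=
  Localization.subalgebra.ofField K M.primeCompl M.primeCompl_le_nonZeroDivisors

variable (K : Type*) {D : Type*} [CommRing D] [IsDomain D] [Field K] [Algebra D K]
  [IsFractionRing D K] in
/-- The family `{D_M | M ∈ Max(D), M ≠ N}`. -/
def localizationsAwayFrom (N : Ideal D) : Set (Subalgebra D K) :=
  {V | ∃ (M : Ideal D) (_ : M.IsMaximal), M ≠ N ∧ V = localizationAt K M}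

end Semistar

/-!
Membership in `E D_M` means that some `s ∉ M` satisfies `s x ∈ E`, so for `⋆ = ∧_W` the element
`x` lies in `E^⋆` exactly when the conductor `(E : x)` is contained in no maximal ideal other than
`M_∞` (`mem_wedge_localizationsAwayFrom_iff`). Everything is done with such conductors.

The heart of the matter is `D^⋆ = D` (`mem_one_of_forall_maximal_ne`). Let `x = a / b` have a
conductor `I = (D : x)` contained in no maximal ideal except possibly `M_∞`. Since all `D_M` are
valuation rings, the ideals `(bD : a)` and `(aD : b)` are comaximal, and this makes `I` generated
by two elements. If `I` were contained in `M_∞`, then `M_∞` would be finitely generated: for `t ∈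
M_∞` a uniformizer of `D_{M_∞}`, the ideals `tD + I` and `M_∞` agree locally everywhere
(`fg_of_fg_le_of_forall_not_le`). Hence `I = D`.

A finitely generated `F` satisfies `s F ⊆ f D ⊆ F` for some `f` and some `s ∉ M_∞`, because `F` is
principal at `M_∞`. Therefore `F^⋆ = F` (`mem_of_forall_maximal_ne_of_fg`), and `⋆_f` is the
identity. On the other hand `(M_∞)^⋆ = D`, because `M_∞` is contained in no other maximal ideal;
so `⋆` is not of finite type. Finally, if `⋆ = b(⋆')`, then `F^{⋆'} ⊆ F^⋆ = F` for all finitely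
generated `F`, so `D_{M_∞}` belongs to `𝒱(⋆')` and `1 ∈ (M_∞)^⋆ ⊆ M_∞ D_{M_∞}`, which is absurd.
-/

namespace Semistar

/-! ### Localizations at primes -/

/-- Membership in a submodule is local: otherwise the conductor `(E : x)` would be contained in a
maximal ideal. -/
theorem mem_of_forall_maximal {D P : Type*} [CommRing D] [AddCommGroup P] [Module D P]
    {E : Submodule D P} {x : P}
    (h : ∀ M : Ideal D, M.IsMaximal → ∃ s ∉ M, s • x ∈ E) : x ∈ E := by
  by_contra hx
  have hne : E.colon {x} ≠ ⊤ := by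
    rw [Ideal.ne_top_iff_one, Submodule.mem_colon_singleton, one_smul]
    exact hx
  obtain ⟨M, hM, hle⟩ := Ideal.exists_le_maximal _ hne
  obtain ⟨s, hs, hsx⟩ := h M hM
  exact hs (hle (Submodule.mem_colon_singleton.2 hsx))

section Localization

variable {D : Type*} [CommRing D] [IsDomain D]

theorem algebraMap_dvd_algebraMap_iff (M : Ideal D) [M.IsPrime] {a b : D} :
    algebraMap D (Localization.AtPrime M) a ∣ algebraMap D (Localization.AtPrime M) b ↔
      ∃ s ∉ M, a ∣ s * b := by
  constructor
  · rintro ⟨q, hq⟩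
    obtain ⟨⟨c, s⟩, hs⟩ := IsLocalization.surj M.primeCompl q
    refine ⟨s, s.2, c, ?_⟩
    apply IsLocalization.injective (Localization.AtPrime M) M.primeCompl_le_nonZeroDivisors
    rw [map_mul, map_mul, hq, ← hs]
    ring
  · rintro ⟨s, hs, h⟩
    have h1 := map_dvd (algebraMap D (Localization.AtPrime M)) h
    rw [map_mul] at h1
    exact (IsLocalization.map_units (Localization.AtPrime M)
      (⟨s, hs⟩ : M.primeCompl)).dvd_mul_left.1 h1

theorem exists_notMem_dvd_or_dvd (M : Ideal D) [M.IsPrime]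
    [ValuationRing (Localization.AtPrime M)] (a b : D) :
    ∃ s ∉ M, a ∣ s * b ∨ b ∣ s * a := by
  rcases ValuationRing.dvd_total (algebraMap D (Localization.AtPrime M) a)
    (algebraMap D (Localization.AtPrime M) b) with h | h
  · obtain ⟨s, hs, h⟩ := (algebraMap_dvd_algebraMap_iff M).1 h
    exact ⟨s, hs, Or.inl h⟩
  · obtain ⟨s, hs, h⟩ := (algebraMap_dvd_algebraMap_iff M).1 h
    exact ⟨s, hs, Or.inr h⟩

/-- A numerator of a uniformizer of `D_M` generates `M` locally at `M`. -/
theorem exists_mem_forall_dvd_mul (M : Ideal D) [M.IsPrime]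
    [IsPrincipalIdealRing (Localization.AtPrime M)] :
    ∃ t ∈ M, ∀ m ∈ M, ∃ s ∉ M, t ∣ s * m := by
  obtain ⟨p, hp⟩ := (IsPrincipalIdealRing.principal
    (IsLocalRing.maximalIdeal (Localization.AtPrime M))).principal
  obtain ⟨⟨t, s⟩, hs⟩ := IsLocalization.surj M.primeCompl p
  have hu := IsLocalization.map_units (Localization.AtPrime M) s
  refine ⟨t, ?_, fun m hm => ?_⟩
  · rw [← IsLocalization.AtPrime.to_map_mem_maximal_iff (Localization.AtPrime M) M, ← hs, hp]
    exact Ideal.mul_mem_right _ _ (Submodule.mem_span_singleton_self p)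
  · rw [← algebraMap_dvd_algebraMap_iff, ← hs, hu.mul_right_dvd, ← Ideal.mem_span_singleton]
    have := (IsLocalization.AtPrime.to_map_mem_maximal_iff (Localization.AtPrime M) M m).2 hm
    rwa [hp] at this

/-- If `D_M` has a principal maximal ideal and `M` contains a finitely generated ideal `I`
contained in no other maximal ideal, then `M` is finitely generated: it equals `tD + I` for `t`
as in `exists_mem_forall_dvd_mul`. -/
theorem fg_of_fg_le_of_forall_not_le {M I : Ideal D} [M.IsMaximal]
    [IsPrincipalIdealRing (Localization.AtPrime M)] (hI : I.FG) (hIM : I ≤ M)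
    (h : ∀ N : Ideal D, N.IsMaximal → N ≠ M → ¬ I ≤ N) : M.FG := by
  obtain ⟨t, htM, ht⟩ := exists_mem_forall_dvd_mul M
  have key : M = Ideal.span {t} ⊔ I := by
    refine le_antisymm (fun m hm => ?_)
      (sup_le ((Ideal.span_singleton_le_iff_mem _).2 htM) hIM)
    refine mem_of_forall_maximal fun N hN => ?_
    by_cases hNM : N = M
    · subst hNM
      obtain ⟨s, hs, hd⟩ := ht m hm
      exact ⟨s, hs, Ideal.mem_sup_left (Ideal.mem_span_singleton.2 hd)⟩
    · obtain ⟨i, hi, hiN⟩ := Set.not_subset.1 (h N hN hNM)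
      exact ⟨i, hiN, Ideal.mem_sup_right (Ideal.mul_mem_right _ _ hi)⟩
  rw [key]
  exact (Submodule.fg_span_singleton t).sup hI

end Localization

section Overring

variable {D K : Type*} [CommRing D] [IsDomain D] [Field K] [Algebra D K] [IsFractionRing D K]

theorem mem_mul_localizationAt_iff (M : Ideal D) [M.IsPrime] (E : Submodule D K) (x : K) :
    x ∈ E * Subalgebra.toSubmodule (localizationAt K M) ↔ ∃ s ∉ M, s • x ∈ E := by
  have hne : ∀ s ∉ M, algebraMap D K s ≠ 0 := fun s hs h => hs <| by
    rw [(FaithfulSMul.algebraMap_eq_zero_iff D K).1 h]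
    exact M.zero_mem
  constructor
  · intro hx
    refine Submodule.mul_induction_on hx ?_ ?_
    · rintro e he v ⟨a, s, hs, rfl⟩
      refine ⟨s, hs, ?_⟩
      have h0 := hne s hs
      have h1 : s • (e * (algebraMap D K a * (algebraMap D K s)⁻¹)) = a • e := by
        rw [Algebra.smul_def, Algebra.smul_def]
        field_simp
      exact h1 ▸ E.smul_mem a he
    · rintro x y ⟨s, hs, hx⟩ ⟨t, ht, hy⟩
      refine ⟨s * t, fun h => (Ideal.IsPrime.mem_or_mem ‹_› h).elim hs ht, ?_⟩
      rw [smul_add]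
      refine E.add_mem ?_ ?_
      · rw [mul_comm, mul_smul]; exact E.smul_mem _ hx
      · rw [mul_smul]; exact E.smul_mem _ hy
  · rintro ⟨s, hs, hx⟩
    have h0 := hne s hs
    have h1 : x = (s • x) * (algebraMap D K 1 * (algebraMap D K s)⁻¹) := by
      rw [Algebra.smul_def, map_one]
      field_simp
    rw [h1]
    exact Submodule.mul_mem_mul hx ⟨1, s, hs, rfl⟩

theorem valuationRing_localizationAt (M : Ideal D) [M.IsPrime]
    [ValuationRing (Localization.AtPrime M)] : ValuationRing (localizationAt K M) := by
  have : IsLocalization M.primeCompl (localizationAt K M) :=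
    Localization.subalgebra.isLocalization_ofField K M.primeCompl M.primeCompl_le_nonZeroDivisors
  let e := IsLocalization.algEquiv M.primeCompl (Localization.AtPrime M) (localizationAt K M)
  exact Function.Surjective.valuationRing (e : Localization.AtPrime M →+* localizationAt K M)
    e.surjective

theorem mem_wedge_localizationsAwayFrom_iff (N : Ideal D) (E : NonzeroSubmodule D K) (x : K) :
    x ∈ ((SemistarOperation.wedge (localizationsAwayFrom K N)).toFun E).1 ↔
      ∀ M : Ideal D, M.IsMaximal → M ≠ N → ∃ s ∉ M, s • x ∈ E.1 := by
  change x ∈ ⨅ V ∈ localizationsAwayFrom K N, E.1 * Subalgebra.toSubmodule V ↔ _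
  simp only [Submodule.mem_iInf]
  constructor
  · intro h M hM hMN
    exact (mem_mul_localizationAt_iff M E.1 x).1 (h _ ⟨M, hM, hMN, rfl⟩)
  · rintro h V ⟨M, hM, hMN, rfl⟩
    exact (mem_mul_localizationAt_iff M E.1 x).2 (h M hM hMN)

end Overring

/-! ### Conductors and finitely generated submodules -/

section Conductor

variable {D K : Type*} [CommRing D] [IsDomain D] [Field K] [Algebra D K]

/-- If all `D_M` are valuation rings, then `(bD : a) + (aD : b) = D` for all `a`, `b`. -/
theorem exists_mul_eq_mul_and_one_sub_mul_eq
    (hV : ∀ (M : Ideal D) [M.IsMaximal], ValuationRing (Localization.AtPrime M)) (a b : D) :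
    ∃ u v w : D, u * a = b * v ∧ (1 - u) * b = a * w := by
  have htop : (Ideal.span {b}).colon {a} ⊔ (Ideal.span {a}).colon {b} = ⊤ := by
    by_contra hne
    obtain ⟨M, hM, hle⟩ := Ideal.exists_le_maximal _ hne
    have := hV M
    obtain ⟨s, hs, h | h⟩ := exists_notMem_dvd_or_dvd M a b
    · exact hs (hle (Ideal.mem_sup_right
        (Submodule.mem_colon_singleton.2 (Ideal.mem_span_singleton.2 h))))
    · exact hs (hle (Ideal.mem_sup_left
        (Submodule.mem_colon_singleton.2 (Ideal.mem_span_singleton.2 h))))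
  obtain ⟨u, hu, u', hu', hsum⟩ := Submodule.mem_sup.1 ((Ideal.eq_top_iff_one _).1 htop)
  obtain ⟨v, hv⟩ := Ideal.mem_span_singleton.1 (Submodule.mem_colon_singleton.1 hu)
  obtain ⟨w, hw⟩ := Ideal.mem_span_singleton.1 (Submodule.mem_colon_singleton.1 hu')
  refine ⟨u, v, w, hv, ?_⟩
  rw [← hsum, add_sub_cancel_left]
  exact hw

variable [IsFractionRing D K]

/-- If all `D_M` are valuation rings, then `(D : x)` is generated by two elements. -/
theorem colon_one_fg
    (hV : ∀ (M : Ideal D) [M.IsMaximal], ValuationRing (Localization.AtPrime M)) (x : K) :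
    ((1 : Submodule D K).colon {x}).FG := by
  obtain ⟨a, b, hb, rfl⟩ := IsFractionRing.div_surjective (A := D) x
  have hb0 : algebraMap D K b ≠ 0 := fun h => nonZeroDivisors.ne_zero hb
    ((FaithfulSMul.algebraMap_eq_zero_iff D K).1 h)
  obtain ⟨u, v, w, huv, huw⟩ := exists_mul_eq_mul_and_one_sub_mul_eq hV a b
  have e1 : u • (algebraMap D K a / algebraMap D K b) = algebraMap D K v := by
    rw [Algebra.smul_def, ← mul_div_assoc, ← map_mul, huv, map_mul, mul_div_cancel_left₀ _ hb0]
  have e2 : w • (algebraMap D K a / algebraMap D K b) = algebraMap D K (1 - u) := by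
    rw [Algebra.smul_def, ← mul_div_assoc, ← map_mul, mul_comm w, ← huw, map_mul,
      mul_div_cancel_right₀ _ hb0]
  suffices h : (1 : Submodule D K).colon {algebraMap D K a / algebraMap D K b} =
      Ideal.span {u, w} by
    rw [h]
    exact Submodule.fg_span (by simp)
  refine le_antisymm (fun d hd => ?_) (Ideal.span_le.2 ?_)
  · obtain ⟨c, hc⟩ := Submodule.mem_one.1 (Submodule.mem_colon_singleton.1 hd)
    -- With `x = a / b` and `c = d x`: `d = d u + d (1 - u) = d u + d (w x) = d u + c w`.
    have h1 : d = d * u + c * w := by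
      apply IsFractionRing.injective D K
      rw [map_add, map_mul, map_mul, hc]
      rw [Algebra.smul_def, map_sub, map_one] at e2
      rw [Algebra.smul_def]
      linear_combination -(algebraMap D K d) * e2
    rw [h1]
    exact Ideal.add_mem _ (Ideal.mul_mem_left _ _ (Ideal.subset_span (by simp)))
      (Ideal.mul_mem_left _ _ (Ideal.subset_span (by simp)))
  · rintro d (rfl | rfl)
    · exact Submodule.mem_colon_singleton.2 (Submodule.mem_one.2 ⟨_, e1.symm⟩)
    · exact Submodule.mem_colon_singleton.2 (Submodule.mem_one.2 ⟨_, e2.symm⟩)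

/-- The inclusion `⋂ {D_M | M ≠ N} ⊆ D`, for `N` not finitely generated: the conductor
`(D : x)` is finitely generated, so it is not contained in `N` either. -/
theorem mem_one_of_forall_maximal_ne (hD : IsAlmostDedekind D) {N : Ideal D} [N.IsMaximal]
    (hN : ¬ N.FG) {x : K}
    (hx : ∀ M : Ideal D, M.IsMaximal → M ≠ N → ∃ s ∉ M, s • x ∈ (1 : Submodule D K)) :
    x ∈ (1 : Submodule D K) := by
  have hV : ∀ (M : Ideal D) [M.IsMaximal], ValuationRing (Localization.AtPrime M) :=
    fun M _ => have := hD M; inferInstance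
  have := hD N
  have hle : ¬ (1 : Submodule D K).colon {x} ≤ N := fun hle =>
    hN <| fg_of_fg_le_of_forall_not_le (colon_one_fg hV x) hle fun M hM hMN h =>
      let ⟨_, hs, hsx⟩ := hx M hM hMN
      hs (h (Submodule.mem_colon_singleton.2 hsx))
  refine mem_of_forall_maximal fun M hM => ?_
  by_cases hMN : M = N
  · subst hMN
    obtain ⟨s, hs, hsM⟩ := Set.not_subset.1 hle
    exact ⟨s, hsM, Submodule.mem_colon_singleton.1 hs⟩
  · exact hx M hM hMN

/-- A finitely generated submodule of `K` is principal locally at `M` if `D_M` is a valuation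
ring. -/
theorem exists_smul_mem_span_singleton (M : Ideal D) [M.IsPrime]
    [ValuationRing (Localization.AtPrime M)] {F : Submodule D K} (hF : F.FG) :
    ∃ f ∈ F, ∃ s ∉ M, ∀ x ∈ F, s • x ∈ Submodule.span D {f} := by
  induction F, hF using Submodule.fg_induction with
  | singleton x =>
    exact ⟨x, Submodule.mem_span_singleton_self x, 1, Ideal.one_notMem M,
      fun y hy => by simpa using hy⟩
  | sup F G _ _ ihF ihG =>
    -- If `s F ⊆ fD`, `t G ⊆ gD` and `r f ∈ gD`, then `r s t (F + G) ⊆ gD`.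
    have key : ∀ {F G : Submodule D K} {f g : K} {s t r : D}, g ∈ G → s ∉ M → t ∉ M → r ∉ M →
        (∀ x ∈ F, s • x ∈ Submodule.span D {f}) → (∀ x ∈ G, t • x ∈ Submodule.span D {g}) →
        r • f ∈ Submodule.span D {g} →
        ∃ f ∈ F ⊔ G, ∃ s ∉ M, ∀ x ∈ F ⊔ G, s • x ∈ Submodule.span D {f} := by
      intro F G f g s t r hg hs ht hr hF hG hfg
      refine ⟨g, Submodule.mem_sup_right hg, r * s * t, ?_, fun x hx => ?_⟩
      · exact fun h => (Ideal.IsPrime.mem_or_mem ‹_› h).elim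
          (fun h => (Ideal.IsPrime.mem_or_mem ‹_› h).elim hr hs) ht
      · obtain ⟨y, hy, z, hz, rfl⟩ := Submodule.mem_sup.1 hx
        rw [smul_add]
        refine add_mem ?_ ?_
        · obtain ⟨c, hc⟩ := Submodule.mem_span_singleton.1 (hF y hy)
          have : (r * s * t) • y = (t * c) • r • f := by
            rw [smul_smul, show r * s * t = r * t * s by ring, mul_smul, ← hc, smul_smul]
            congr 1
            ring
          rw [this]
          exact Submodule.smul_mem _ _ hfg
        · rw [mul_smul]
          exact Submodule.smul_mem _ _ (hG z hz)
    obtain ⟨f, hf, s, hs, hF⟩ := ihF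
    obtain ⟨g, hg, t, ht, hG⟩ := ihG
    -- Clearing denominators, `b f` and `b g` lie in `D`, where they can be compared at `M`.
    classical
    obtain ⟨b, hb⟩ := IsLocalization.exist_integer_multiples_of_finset D⁰ ({f, g} : Finset K)
    obtain ⟨p, hp⟩ := hb f (by simp)
    obtain ⟨q, hq⟩ := hb g (by simp)
    have hb0 : algebraMap D K b ≠ 0 := fun h => nonZeroDivisors.ne_zero b.2
      ((FaithfulSMul.algebraMap_eq_zero_iff D K).1 h)
    have compare : ∀ {p q r : D} {f g : K}, algebraMap D K p = (b : D) • f →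
        algebraMap D K q = (b : D) • g → q ∣ r * p → r • f ∈ Submodule.span D {g} := by
      rintro p q r f g hp hq ⟨c, hc⟩
      refine Submodule.mem_span_singleton.2 ⟨c, mul_left_cancel₀ hb0 ?_⟩
      have h1 := congrArg (algebraMap D K) hc
      rw [map_mul, map_mul, hp, hq] at h1
      simp only [Algebra.smul_def] at h1 ⊢
      linear_combination -h1
    obtain ⟨r, hr, h | h⟩ := exists_notMem_dvd_or_dvd M p q
    · rw [sup_comm]
      exact key hf ht hs hr hG hF (compare hq hp h)
    · exact key hg hs ht hr hF hG (compare hp hq h)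

/-- The inclusion `⋂ {F D_M | M ≠ N} ⊆ F`, for `F` finitely generated and `N` not: `F` is
principal locally at `N`, which reduces the claim to the case `F = D`. -/
theorem mem_of_forall_maximal_ne_of_fg (hD : IsAlmostDedekind D) {N : Ideal D} [N.IsMaximal]
    (hN : ¬ N.FG) {F : Submodule D K} (hF : F.FG) (hF0 : F ≠ ⊥) {x : K}
    (hx : ∀ M : Ideal D, M.IsMaximal → M ≠ N → ∃ s ∉ M, s • x ∈ F) : x ∈ F := by
  refine mem_of_forall_maximal fun M hM => ?_
  by_cases hMN : M ≠ N
  · exact hx M hM hMN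
  obtain rfl := not_ne_iff.1 hMN
  have := hD M
  obtain ⟨f, hf, s, hs, hsF⟩ := exists_smul_mem_span_singleton M hF
  refine ⟨s, hs, ?_⟩
  have hf0 : f ≠ 0 := by
    rintro rfl
    refine hF0 ((Submodule.eq_bot_iff _).2 fun y hy => ?_)
    have h1 : s • y = 0 := by simpa using hsF y hy
    exact (smul_eq_zero.1 h1).resolve_left fun h => hs (h ▸ M.zero_mem)
  -- `s x / f` lies in `D_P` for all `P ≠ M`, hence in `D`.
  have h1 : f⁻¹ * s • x ∈ (1 : Submodule D K) := by
    refine mem_one_of_forall_maximal_ne hD hN fun P hP hPM => ?_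
    obtain ⟨r, hr, hrx⟩ := hx P hP hPM
    obtain ⟨c, hc⟩ := Submodule.mem_span_singleton.1 (hsF _ hrx)
    refine ⟨r, hr, Submodule.mem_one.2 ⟨c, ?_⟩⟩
    rw [← mul_smul_comm, smul_comm r s x, ← hc, Algebra.smul_def]
    field_simp
  obtain ⟨c, hc⟩ := Submodule.mem_one.1 h1
  have h2 : s • x = c • f := by
    rw [Algebra.smul_def c, hc]
    field_simp
  exact h2 ▸ F.smul_mem c hf

end Conductor

/-! ### Semistar operations fixing the finitely generated submodules -/

section FixesFinitelyGenerated

variable {D K : Type*} [CommRing D] [Field K] [Algebra D K]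

theorem finiteType_eq_identity {s : SemistarOperation D K}
    (hs : ∀ F : NonzeroSubmodule D K, F.1.FG → s.toFun F = F) :
    s.finiteType = SemistarOperation.identity D K := by
  refine SemistarOperation.ext (funext fun E => le_antisymm ?_ (s.finiteType.le_self E))
  rintro x ⟨F, hF, hFE, hx⟩
  rw [hs F hF] at hx
  exact hFE hx

/-- If `⋆ = b(⋆')` fixes every finitely generated `F`, then `F^{⋆'} ⊆ F^{b(⋆')} = F`, so every
valuation overring of `D` belongs to `𝒱(⋆')`. -/
theorem mem_valuationOverrings_of_complete_fixes_fg {s : SemistarOperation D K}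
    (hfg : ∀ F : NonzeroSubmodule D K, F.1.FG → s.complete.toFun F = F)
    (V : Subalgebra D K) (hV : ValuationRing V) : V ∈ s.valuationOverrings := by
  refine ⟨hV, fun F hF => ?_⟩
  have h1 : s.toFun F ≤ s.complete.toFun F :=
    le_iInf₂ (f := fun V (_ : V ∈ s.valuationOverrings) => F.1 * Subalgebra.toSubmodule V)
      fun U hU => hU.2 F hF
  rw [hfg F hF] at h1
  exact le_trans h1 (SemistarOperation.le_mul_overring F.1 V)

end FixesFinitelyGenerated

/-! ### The operation defined by the localizations away from one maximal ideal -/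

theorem ofIdeal_le_base {D K : Type*} [CommRing D] [Field K] [Algebra D K] [IsFractionRing D K]
    {I : Ideal D} (hI : I ≠ ⊥) :
    NonzeroSubmodule.ofIdeal K I hI ≤ NonzeroSubmodule.base D K := by
  rintro _ ⟨d, -, rfl⟩
  exact Submodule.mem_one.2 ⟨d, rfl⟩

section Wedge

variable {D K : Type*} [CommRing D] [IsDomain D] [Field K] [Algebra D K] [IsFractionRing D K]

theorem wedge_eq_self_of_fg (hD : IsAlmostDedekind D) {N : Ideal D} [N.IsMaximal] (hN : ¬ N.FG)
    (F : NonzeroSubmodule D K) (hF : F.1.FG) :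
    (SemistarOperation.wedge (localizationsAwayFrom K N)).toFun F = F := by
  refine le_antisymm (fun x hx => ?_) (SemistarOperation.le_self _ F)
  exact mem_of_forall_maximal_ne_of_fg hD hN hF F.2
    ((mem_wedge_localizationsAwayFrom_iff N F x).1 hx)

theorem wedge_base (hD : IsAlmostDedekind D) {N : Ideal D} [N.IsMaximal] (hN : ¬ N.FG) :
    (SemistarOperation.wedge (localizationsAwayFrom K N)).toFun (NonzeroSubmodule.base D K) =
      NonzeroSubmodule.base D K :=
  wedge_eq_self_of_fg hD hN _ ⟨{1}, by simp [NonzeroSubmodule.base, Submodule.one_eq_span]⟩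

theorem one_mem_wedge_ofIdeal {N : Ideal D} [hN : N.IsMaximal] (h0 : N ≠ ⊥) :
    (1 : K) ∈ ((SemistarOperation.wedge (localizationsAwayFrom K N)).toFun
      (NonzeroSubmodule.ofIdeal K N h0)).1 := by
  refine (mem_wedge_localizationsAwayFrom_iff N _ 1).2 fun M hM hMN => ?_
  obtain ⟨s, hs, hsM⟩ := Set.not_subset.1 fun h : N ≤ M => hMN (hN.eq_of_le hM.ne_top h).symm
  exact ⟨s, hsM, s, hs, by simp [Algebra.smul_def]⟩

theorem wedge_ofIdeal (hD : IsAlmostDedekind D) {N : Ideal D} [N.IsMaximal] (hN : ¬ N.FG) :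
    (SemistarOperation.wedge (localizationsAwayFrom K N)).toFun
      (NonzeroSubmodule.ofIdeal K N (ne_bot_of_not_fg hN)) = NonzeroSubmodule.base D K := by
  refine le_antisymm ?_ ?_
  · exact (SemistarOperation.mono _ _ _ (ofIdeal_le_base _)).trans (wedge_base hD hN).le
  · exact Submodule.one_le.2 (one_mem_wedge_ofIdeal _)

theorem one_notMem_ofIdeal {I : Ideal D} (hI : I ≠ ⊤) (h0 : I ≠ ⊥) :
    (1 : K) ∉ (NonzeroSubmodule.ofIdeal K I h0).1 := by
  rintro ⟨d, hd, h1⟩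
  have : d = 1 := IsFractionRing.injective D K (by simpa using h1)
  exact hI ((Ideal.eq_top_iff_one I).2 (this ▸ hd))

theorem isFractional_toFun {s : SemistarOperation D K}
    (hs : s.toFun (NonzeroSubmodule.base D K) = NonzeroSubmodule.base D K)
    {E : NonzeroSubmodule D K} (hE : IsFractional D⁰ E.1) : IsFractional D⁰ (s.toFun E).1 := by
  obtain ⟨a, ha, h⟩ := hE
  have ha0 : algebraMap D K a ≠ 0 := fun h => nonZeroDivisors.ne_zero ha
    ((FaithfulSMul.algebraMap_eq_zero_iff D K).1 h)
  -- `aE ⊆ D` gives `a E^⋆ = (aE)^⋆ ⊆ D^⋆ = D`.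
  have h1 : E.scale _ ha0 ≤ NonzeroSubmodule.base D K := by
    intro x hx
    obtain ⟨e, he, rfl⟩ := (Submodule.mem_smul_pointwise_iff_exists _ _ _).1 hx
    obtain ⟨d, hd⟩ := h e he
    exact Submodule.mem_one.2 ⟨d, by rw [hd, Algebra.smul_def, smul_eq_mul]⟩
  have h2 := s.mono _ _ h1
  rw [s.map_scale, hs] at h2
  refine ⟨a, ha, fun x hx => ?_⟩
  obtain ⟨d, hd⟩ := Submodule.mem_one.1
    (h2 ((Submodule.mem_smul_pointwise_iff_exists _ _ _).2 ⟨x, hx, rfl⟩))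
  exact ⟨d, by rw [hd, smul_eq_mul, Algebra.smul_def]⟩

/-- The star operation obtained by restricting a semistar operation `⋆` with `D^⋆ = D` to the
nonzero fractional ideals. -/
def restrict (s : SemistarOperation D K)
    (hs : s.toFun (NonzeroSubmodule.base D K) = NonzeroSubmodule.base D K) :
    StarOperation D K where
  toFun E := ⟨(s.toFun E.toSubmodule).1, (s.toFun E.toSubmodule).2, isFractional_toFun hs E.2.2⟩
  map_principal z hz := by
    have h := s.map_scale z hz (NonzeroSubmodule.base D K)
    rw [hs] at h
    exact Subtype.ext (congrArg (fun F : NonzeroSubmodule D K => F.1) h)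
  map_scale z hz E := Subtype.ext <|
    congrArg (fun F : NonzeroSubmodule D K => F.1) (s.map_scale z hz E.toSubmodule)
  mono E F h := s.mono E.toSubmodule F.toSubmodule h
  le_self E := s.le_self E.toSubmodule
  idem E := Subtype.ext <|
    congrArg (fun F : NonzeroSubmodule D K => F.1) (s.idem E.toSubmodule)

theorem not_isFiniteType_restrict {s : SemistarOperation D K}
    (hs : s.toFun (NonzeroSubmodule.base D K) = NonzeroSubmodule.base D K)
    (hfg : ∀ F : NonzeroSubmodule D K, F.1.FG → s.toFun F = F)
    {E : NonzeroSubmodule D K} (hE : IsFractional D⁰ E.1) {x : K} (hx : x ∈ (s.toFun E).1)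
    (hxE : x ∉ E.1) : ¬ (restrict s hs).IsFiniteType := by
  intro h
  obtain ⟨F, hF, hFE, hxF⟩ := (h ⟨E.1, E.2, hE⟩ x).1 hx
  have h1 : x ∈ (s.toFun F.toSubmodule).1 := hxF
  rw [hfg F.toSubmodule hF] at h1
  exact hxE (hFE h1)

theorem wedge_ne_complete (hD : IsAlmostDedekind D) {N : Ideal D} [hmax : N.IsMaximal]
    (hN : ¬ N.FG) (s : SemistarOperation D K) :
    SemistarOperation.wedge (localizationsAwayFrom K N) ≠ s.complete := by
  intro h
  have := hD N
  have hmem := mem_valuationOverrings_of_complete_fixes_fg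
    (fun F hF => h ▸ wedge_eq_self_of_fg hD hN F hF) (localizationAt K N)
    (valuationRing_localizationAt N)
  have h1 := one_mem_wedge_ofIdeal (K := K) (ne_bot_of_not_fg hN)
  rw [h] at h1
  have h2 : (s.complete.toFun (NonzeroSubmodule.ofIdeal K N (ne_bot_of_not_fg hN))).1 ≤ _ :=
    iInf₂_le (f := fun V (_ : V ∈ s.valuationOverrings) =>
      (NonzeroSubmodule.ofIdeal K N (ne_bot_of_not_fg hN)).1 * Subalgebra.toSubmodule V) _ hmem
  obtain ⟨r, hr, d, hd, hdr⟩ := (mem_mul_localizationAt_iff N _ _).1 (h2 h1)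
  have : d = r := IsFractionRing.injective D K (by simpa [Algebra.smul_def] using hdr)
  exact hr (this ▸ hd)

end Wedge

end Semistar

theorem mainTheorem4 {D K : Type*} [CommRing D] [IsDomain D] [Field K] [Algebra D K]
    [IsFractionRing D K] (hD : Semistar.IsAlmostDedekind D)
    (Minf : Ideal D) (hmax : Minf.IsMaximal) (hMinf : ¬ Minf.FG)
    (hfg : ∀ M : Ideal D, M.IsMaximal → M ≠ Minf → M.FG)
    (W : Set (Subalgebra D K)) (hW : W = Semistar.localizationsAwayFrom K Minf)
    (star : Semistar.SemistarOperation D K)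
    (hstar : star = Semistar.SemistarOperation.wedge W) :
    -- every member of `W` is a valuation overring, so that `⋆ = ∧_W` is a `W`-operation
    (∀ V ∈ W, ValuationRing V) ∧ star.IsWOperation ∧
    -- `D^⋆ = D`
    star.toFun (Semistar.NonzeroSubmodule.base D K) = Semistar.NonzeroSubmodule.base D K ∧
    -- `⋆` restricts to a star operation on the nonzero fractional ideals, not of finite type
    (∃ r : Semistar.StarOperation D K,
      (∀ E : Semistar.NonzeroFractional D K,
        (r.toFun E).toSubmodule = star.toFun E.toSubmodule) ∧
      ¬ r.IsFiniteType) ∧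
    -- `⋆_f` is the identity
    star.finiteType = Semistar.SemistarOperation.identity D K ∧
    -- `(M_∞)^⋆ = D`
    star.toFun (Semistar.NonzeroSubmodule.ofIdeal K Minf (Semistar.ne_bot_of_not_fg hMinf)) =
      Semistar.NonzeroSubmodule.base D K ∧
    -- `⋆` is not of finite type
    ¬ star.IsFiniteType ∧
    -- `⋆ ≠ b(⋆)`, and `⋆ ≠ b(⋆')` for every semistar operation `⋆'`
    ¬ star.IsCompleteWOperation ∧
    (∀ star' : Semistar.SemistarOperation D K, star ≠ star'.complete) := by
  subst hstar hW
  have hfix := Semistar.wedge_eq_self_of_fg (K := K) hD hMinf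
  have hbase := Semistar.wedge_base (K := K) hD hMinf
  have hV : ∀ V ∈ Semistar.localizationsAwayFrom K Minf, ValuationRing V := by
    rintro V ⟨M, hM, -, rfl⟩
    have := hD M
    exact Semistar.valuationRing_localizationAt M
  have hone := Semistar.one_mem_wedge_ofIdeal (K := K) (Semistar.ne_bot_of_not_fg hMinf)
  have hnot := Semistar.one_notMem_ofIdeal (K := K) hmax.ne_top (Semistar.ne_bot_of_not_fg hMinf)
  refine ⟨hV, ⟨_, hV, rfl⟩, hbase, ⟨Semistar.restrict _ hbase, fun E => rfl, ?_⟩,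
    Semistar.finiteType_eq_identity hfix, Semistar.wedge_ofIdeal hD hMinf, fun h => ?_,
    Semistar.wedge_ne_complete hD hMinf _, Semistar.wedge_ne_complete hD hMinf⟩
  · exact Semistar.not_isFiniteType_restrict hbase hfix
      (FractionalIdeal.isFractional_of_le_one _ (Semistar.ofIdeal_le_base _)) hone hnot
  · rw [Semistar.SemistarOperation.IsFiniteType, Semistar.finiteType_eq_identity hfix] at h
    rw [h] at hone
    exact hnot hone
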